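/- Let $c_0$ be the Banach space of complex sequences $z=(z_j)_{j\ge 1}$ tending to $0$, with the norm $\|z\|=\sup_j|z_j|$, and let $\mathbf B$ be its open unit ball. Let $A^+(\mathbb T^\infty)$ be the algebra of all functions $f:\mathbf B\to\mathbb C$ of the form $f(z)=\sum_{\alpha}a_\alpha z^\alpha$, where $\alpha$ ranges over the finitely supported sequences of non-negative integers, $z^\alpha=\prod_j z_j^{\alpha_j}$ and $\|f\|:=\sum_\alpha|a_\alpha|<\infty$. Let $\phi=(\phi_j)_{j\ge 1}:\mathbf B\to\mathbf B$ be an analytic map such that $C_\phi: f\mapsto f\circ\phi$ maps $A^+(\mathbb T^\infty)$ into itself. Then: (a) If there are a permutation $\sigma$ of $\mathbb N=\{1,2,\dots\}$ and complex numbers $\epsilon_j$ with $|\epsilon_j|=1$ such that $\phi(z)=(\epsilon_j z_{\sigma(j)})_{j\ge 1}$ for all $z\in\mathbf B$, then $C_\phi$ is an automorphism of the algebra $A^+(\mathbb T^\infty)$, and it is isometric: $\|C_\phi f\|=\|f\|$ for all $f$. (b) If $C_\phi$ is an automorphism of the algebra $A^+(\mathbb T^\infty)$ and if, moreover, for each $k$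 there are an integer $d_k\ge 1$ and a continuous function $u_k:\mathbf B\to\mathbb C$ with $u_k(0)\ne 0$ such that $\phi_k(z)=z_k^{d_k}u_k(z)$ for all $z\in\mathbf B$, then there are complex numbers $\epsilon_j$ with $|\epsilon_j|=1$ such that $\phi(z)=(\epsilon_j z_j)_{j\ge 1}$ for all $z\in\mathbf B$. -/

import Mathlib

namespace WienerPolydisc

open scoped ZeroAtInfty

/-- The Banach space `c₀` of complex sequences tending to zero, with the supremum norm
(on the discrete space `ℕ`, "vanishing at infinity" means "tending to `0`"). -/
abbrev C0 : Type := C₀(ℕ, ℂ)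

/-- The open unit ball of `c₀`. -/
abbrev B : Set C0 := Metric.ball (0 : C0) 1

/-- The monomial `z ^ α = ∏ j, z j ^ α j`, for a finitely supported multi-index `α`. -/
noncomputable def monom (α : ℕ →₀ ℕ) (z : C0) : ℂ := α.prod fun j m => z j ^ m

/-- `a` is a family of coefficients of an absolutely convergent Taylor series with sum `f`:
`∑ |a α| < ∞` and `f z = ∑ a α z ^ α` on the ball. -/
structure IsExpansion (a : (ℕ →₀ ℕ) → ℂ) (f : B → ℂ) : Prop where
  summable : Summable fun α => ‖a α‖
  hasSum : ∀ z : B, HasSum (fun α => a α * monom α z) (f z)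

theorem mem_B_iff {z : C0} : z ∈ B ↔ ‖z‖ < 1 := mem_ball_zero_iff

theorem norm_apply_lt_one (z : B) (j : ℕ) : ‖(z : C0) j‖ < 1 :=
  lt_of_le_of_lt (BoundedContinuousFunction.norm_coe_le_norm (z : C0).toBCF j)
    (mem_B_iff.1 z.2)

theorem norm_monom_le_one (α : ℕ →₀ ℕ) (z : B) : ‖monom α z‖ ≤ 1 := by
  unfold monom Finsupp.prod
  rw [norm_prod]
  refine Finset.prod_le_one (fun _ _ => norm_nonneg _) fun j _ => ?_
  rw [norm_pow]
  exact pow_le_one₀ (norm_nonneg _) (norm_apply_lt_one z j).le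

theorem monom_zero (z : C0) : monom 0 z = 1 := Finsupp.prod_zero_index

theorem monom_add (α β : ℕ →₀ ℕ) (z : C0) : monom (α + β) z = monom α z * monom β z :=
  Finsupp.prod_add_index' (fun _ => pow_zero _) fun _ _ _ => pow_add _ _ _

theorem summable_norm_mul_monom {a : (ℕ →₀ ℕ) → ℂ} (ha : Summable fun α => ‖a α‖) (z : B) :
    Summable fun α => ‖a α * monom α z‖ := by
  refine ha.of_nonneg_of_le (fun _ => norm_nonneg _) fun α => ?_
  rw [norm_mul]
  exact mul_le_of_le_one_right (norm_nonneg _) (norm_monom_le_one α z)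

theorem IsExpansion.const (c : ℂ) : IsExpansion (Pi.single 0 c) fun _ => c where
  summable := by
    refine summable_of_ne_finset_zero (s := {0}) fun α hα => ?_
    have h : α ≠ 0 := by simpa using hα
    simp [h]
  hasSum z := by
    have h := hasSum_single (f := fun α : ℕ →₀ ℕ => (Pi.single 0 c : (ℕ →₀ ℕ) → ℂ) α * monom α z)
      0 fun α hα => by simp [hα]
    simpa [monom_zero] using h

theorem IsExpansion.add {a b : (ℕ →₀ ℕ) → ℂ} {f g : B → ℂ} (hf : IsExpansion a f)
    (hg : IsExpansion b g) : IsExpansion (a + b) (f + g) where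
  summable := (hf.summable.add hg.summable).of_nonneg_of_le (fun _ => norm_nonneg _)
    fun α => norm_add_le (a α) (b α)
  hasSum z := by simpa [add_mul] using (hf.hasSum z).add (hg.hasSum z)

/-- The coefficients of the product of two power series. -/
noncomputable def conv (a b : (ℕ →₀ ℕ) → ℂ) (α : ℕ →₀ ℕ) : ℂ :=
  ∑ p ∈ Finset.HasAntidiagonal.antidiagonal α, a p.1 * b p.2

theorem summable_norm_conv {a b : (ℕ →₀ ℕ) → ℂ} (ha : Summable fun α => ‖a α‖)
    (hb : Summable fun α => ‖b α‖) : Summable fun α => ‖conv a b α‖ := by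
  have h : Summable fun α : ℕ →₀ ℕ => ∑ p ∈ Finset.HasAntidiagonal.antidiagonal α,
      ‖a p.1‖ * ‖b p.2‖ :=
    summable_sum_mul_antidiagonal_of_summable_mul (f := fun α => ‖a α‖) (g := fun α => ‖b α‖)
      (Summable.mul_of_nonneg ha hb (fun _ => norm_nonneg _) fun _ => norm_nonneg _)
  refine Summable.of_nonneg_of_le (fun _ => norm_nonneg _) (fun α => ?_) h
  unfold conv
  refine (norm_sum_le _ _).trans (Finset.sum_le_sum fun p _ => ?_)
  rw [norm_mul]

theorem conv_mul_monom (a b : (ℕ →₀ ℕ) → ℂ) (z : C0) (α : ℕ →₀ ℕ) :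
    conv a b α * monom α z =
      conv (fun α => a α * monom α z) (fun α => b α * monom α z) α := by
  unfold conv
  rw [Finset.sum_mul]
  refine Finset.sum_congr rfl fun p hp => ?_
  have hp' : p.1 + p.2 = α := Finset.HasAntidiagonal.mem_antidiagonal.1 hp
  rw [← hp', monom_add, mul_mul_mul_comm]

theorem hasSum_conv {a b : (ℕ →₀ ℕ) → ℂ} (ha : Summable fun α => ‖a α‖)
    (hb : Summable fun α => ‖b α‖) : HasSum (conv a b) ((∑' α, a α) * ∑' α, b α) := by
  have hs : Summable fun p : (ℕ →₀ ℕ) × (ℕ →₀ ℕ) => a p.1 * b p.2 :=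
    summable_mul_of_summable_norm ha hb
  rw [Summable.tsum_mul_tsum_eq_tsum_sum_antidiagonal ha.of_norm hb.of_norm hs]
  exact (summable_sum_mul_antidiagonal_of_summable_mul hs).hasSum

theorem IsExpansion.mul {a b : (ℕ →₀ ℕ) → ℂ} {f g : B → ℂ} (hf : IsExpansion a f)
    (hg : IsExpansion b g) : IsExpansion (conv a b) (f * g) where
  summable := summable_norm_conv hf.summable hg.summable
  hasSum z := by
    have h := hasSum_conv (summable_norm_mul_monom hf.summable z)
      (summable_norm_mul_monom hg.summable z)
    rw [(hf.hasSum z).tsum_eq, (hg.hasSum z).tsum_eq] at h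
    have e : (fun α => conv a b α * monom α z) =
        conv (fun α => a α * monom α z) (fun α => b α * monom α z) :=
      funext fun α => conv_mul_monom a b z α
    rw [e]
    exact h

/-- The Wiener algebra in countably many variables: the algebra (for the pointwise operations)
of all functions on the ball that are sums of absolutely convergent Taylor series
`∑ a α z ^ α` with `∑ |a α| < ∞`. -/
def wienerAlgebra : Subalgebra ℂ (B → ℂ) where
  carrier := {f | ∃ a, IsExpansion a f}
  mul_mem' := by
    rintro f g ⟨a, ha⟩ ⟨b, hb⟩
    exact ⟨_, ha.mul hb⟩
  add_mem' := by
    rintro f g ⟨a, ha⟩ ⟨b, hb⟩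
    exact ⟨_, ha.add hb⟩
  algebraMap_mem' c := ⟨_, IsExpansion.const c⟩

/-- The Taylor coefficients of an element of the Wiener algebra (they are unique, see
`coeff_eq`). -/
noncomputable def coeff (f : wienerAlgebra) : (ℕ →₀ ℕ) → ℂ := Classical.choose f.2

/-- The norm of the Wiener algebra, `‖f‖ = ∑ |a α|`. -/
noncomputable def wienerNorm (f : wienerAlgebra) : ℝ := ∑' α, ‖coeff f α‖

theorem isExpansion_coeff (f : wienerAlgebra) : IsExpansion (coeff f) f :=
  Classical.choose_spec f.2

/-- The positive integer `∏ j, p j ^ α j`, where `p 0 < p 1 < ...` are the primes. -/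
noncomputable def primeProd (α : ℕ →₀ ℕ) : ℕ := α.prod fun j m => Nat.nth Nat.Prime j ^ m

theorem primeProd_injective : Function.Injective primeProd := by
  have hinj : Function.Injective (Nat.nth Nat.Prime) := Nat.nth_injective Nat.infinite_setOfPred_prime
  have h : ∀ α, (primeProd α).factorization = α.mapDomain (Nat.nth Nat.Prime) := by
    intro α
    have h1 : primeProd α = (α.mapDomain (Nat.nth Nat.Prime)).prod fun p m => p ^ m :=
      (Finsupp.prod_mapDomain_index_inj hinj).symm
    rw [h1]
    refine Nat.prod_pow_factorization_eq_self fun p hp => ?_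
    obtain ⟨j, -, rfl⟩ := Finset.mem_image.1 (Finsupp.mapDomain_support hp)
    exact Nat.prime_nth_prime j
  intro α β hαβ
  exact Finsupp.mapDomain_injective hinj ((h α).symm.trans ((congrArg _ hαβ).trans (h β)))

theorem primeProd_ne_zero (α : ℕ →₀ ℕ) : primeProd α ≠ 0 :=
  Finset.prod_ne_zero_iff.2 fun j _ => pow_ne_zero _ (Nat.prime_nth_prime j).ne_zero

/-- The point `(p j ^ (-x))` of `c₀`, for `x > 0`. -/
theorem exists_primePoint {x : ℝ} (hx : 0 < x) :
    ∃ z : B, ∀ j, (z : C0) j = (Nat.nth Nat.Prime j : ℂ) ^ (-(x : ℂ)) := by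
  have hn : ∀ j, ‖(Nat.nth Nat.Prime j : ℂ) ^ (-(x : ℂ))‖ = (Nat.nth Nat.Prime j : ℝ) ^ (-x) := by
    intro j
    rw [Complex.norm_natCast_cpow_of_pos (Nat.prime_nth_prime j).pos]
    simp
  have ht : Filter.Tendsto (fun j => (Nat.nth Nat.Prime j : ℂ) ^ (-(x : ℂ)))
      (Filter.cocompact ℕ) (nhds 0) := by
    rw [Filter.cocompact_eq_cofinite, Nat.cofinite_eq_atTop, tendsto_zero_iff_norm_tendsto_zero]
    simp only [hn]
    refine (tendsto_rpow_neg_atTop hx).comp (tendsto_natCast_atTop_atTop.comp ?_)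
    exact (Nat.nth_strictMono Nat.infinite_setOfPred_prime).tendsto_atTop
  let z : C0 := ⟨⟨fun j => (Nat.nth Nat.Prime j : ℂ) ^ (-(x : ℂ)), continuous_of_discreteTopology⟩,
    ht⟩
  have hz : ‖z‖ ≤ (2 : ℝ) ^ (-x) := by
    refine (BoundedContinuousFunction.norm_le (f := z.toBCF) (by positivity)).2 fun j => ?_
    refine (hn j).le.trans ?_
    refine Real.rpow_le_rpow_of_nonpos (by norm_num) ?_ (by linarith)
    exact_mod_cast (Nat.prime_nth_prime j).two_le
  refine ⟨⟨z, mem_B_iff.2 (hz.trans_lt ?_)⟩, fun j => rfl⟩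
  exact Real.rpow_lt_one_of_one_lt_of_neg (by norm_num) (by linarith)

theorem monom_primePoint {x : ℝ} {z : C0}
    (hz : ∀ j, z j = (Nat.nth Nat.Prime j : ℂ) ^ (-(x : ℂ))) (α : ℕ →₀ ℕ) :
    monom α z = (primeProd α : ℂ) ^ (-(x : ℂ)) := by
  let g : ℕ →* ℂ :=
    { toFun := fun n => (n : ℂ) ^ (-(x : ℂ))
      map_one' := by simp
      map_mul' := fun m n => by
        rw [Nat.cast_mul, Complex.natCast_mul_natCast_cpow] }
  have h : g (primeProd α) = α.prod fun j m => g (Nat.nth Nat.Prime j) ^ m := by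
    unfold primeProd Finsupp.prod
    rw [map_prod]
    exact Finset.prod_congr rfl fun j _ => map_pow _ _ _
  refine Eq.trans ?_ h.symm
  unfold monom Finsupp.prod
  exact Finset.prod_congr rfl fun j _ => congrArg (· ^ α j) (hz j)

/-- The Taylor coefficients of a function on the ball are unique. -/
theorem IsExpansion.unique {a b : (ℕ →₀ ℕ) → ℂ} {f : B → ℂ} (ha : IsExpansion a f)
    (hb : IsExpansion b f) : a = b := by
  have aux : ∀ {a : (ℕ →₀ ℕ) → ℂ}, IsExpansion a f →
      LSeries.abscissaOfAbsConv (Function.extend primeProd a 0) < ⊤ ∧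
      ∀ x : ℝ, 0 < x → ∀ z : B, (∀ j, (z : C0) j = (Nat.nth Nat.Prime j : ℂ) ^ (-(x : ℂ))) →
        LSeries (Function.extend primeProd a 0) x = f z := by
    intro a ha
    have hs : ∀ x : ℝ, 0 < x → ∀ z : B,
        (∀ j, (z : C0) j = (Nat.nth Nat.Prime j : ℂ) ^ (-(x : ℂ))) →
        HasSum (LSeries.term (Function.extend primeProd a 0) x) (f z) := by
      intro x hx z hz
      refine (primeProd_injective.hasSum_iff ?_).1 ?_
      · intro n hn
        have h0 : Function.extend primeProd a 0 n = 0 :=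
          Function.extend_apply' _ _ _ fun ⟨α, h⟩ => hn ⟨α, h⟩
        rcases eq_or_ne n 0 with rfl | h
        · simp
        · simp [LSeries.term_of_ne_zero h, h0]
      · have hfun : LSeries.term (Function.extend primeProd a 0) x ∘ primeProd =
            fun α => a α * monom α z := by
          funext α
          rw [Function.comp_apply, LSeries.term_of_ne_zero (primeProd_ne_zero α),
            primeProd_injective.extend_apply, monom_primePoint hz, Complex.cpow_neg,
            div_eq_mul_inv]
        rw [hfun]
        exact ha.hasSum z
    refine ⟨?_, fun x hx z hz => (hs x hx z hz).tsum_eq⟩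
    obtain ⟨z, hz⟩ := exists_primePoint one_pos
    refine (LSeriesSummable.abscissaOfAbsConv_le (s := ((1 : ℝ) : ℂ)) ?_).trans_lt ?_
    · exact (hs 1 one_pos z hz).summable
    · exact EReal.coe_lt_top _
  have hA := aux ha
  have hB := aux hb
  funext α
  have h := LSeries.eq_of_LSeries_eventually_eq hA.1 hB.1 ?_ (primeProd_ne_zero α)
  · rwa [primeProd_injective.extend_apply, primeProd_injective.extend_apply] at h
  · filter_upwards [Filter.eventually_gt_atTop 0] with x hx
    obtain ⟨z, hz⟩ := exists_primePoint hx
    rw [hA.2 x hx z hz, hB.2 x hx z hz]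

theorem coeff_eq (f : wienerAlgebra) {a : (ℕ →₀ ℕ) → ℂ} (ha : IsExpansion a f) : coeff f = a :=
  (isExpansion_coeff f).unique ha

/-- `C_φ` maps the Wiener algebra into itself: `f ∘ φ` belongs to it whenever `f` does. -/
def MapsWienerAlgebra (φ : B → B) : Prop := ∀ f ∈ wienerAlgebra, f ∘ φ ∈ wienerAlgebra

/-- The composition operator `C_φ f = f ∘ φ` on the Wiener algebra. -/
def compOp (φ : B → B) (h : MapsWienerAlgebra φ) : wienerAlgebra →ₐ[ℂ] wienerAlgebra where
  toFun f := ⟨f.1 ∘ φ, h f.1 f.2⟩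
  map_one' := rfl
  map_mul' _ _ := rfl
  map_zero' := rfl
  map_add' _ _ := rfl
  commutes' _ := rfl

/-- An endomorphism of the Wiener algebra is an automorphism if it is an algebra isomorphism of
the Wiener algebra onto itself. -/
def IsAutomorphism (T : wienerAlgebra →ₐ[ℂ] wienerAlgebra) : Prop :=
  ∃ e : wienerAlgebra ≃ₐ[ℂ] wienerAlgebra, (e : wienerAlgebra →ₐ[ℂ] wienerAlgebra) = T

/-- An endomorphism of the Wiener algebra is isometric if it preserves the norm. -/
def IsIsometric (T : wienerAlgebra →ₐ[ℂ] wienerAlgebra) : Prop :=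
  ∀ f, wienerNorm (T f) = wienerNorm f

end WienerPolydisc

/-!
For (a), composition with `z ↦ (ε j * z (σ j))` permutes the Taylor coefficients up to unimodular
factors, so it is a bijection that preserves `∑ |a α|`.

For (b), only two consequences of the hypotheses matter: `C_φ` is onto, and `φ z k = 0` whenever
`z k = 0`. By the second one, `φ` maps the `k`-th coordinate axis into itself by some
`g : 𝔻 → 𝔻` with `g 0 = 0`. By the first one, `z k = f (φ z)` for some `f` in the algebra, whose
restriction `h` to the axis satisfies `h ∘ g = id`. If `|c| > 1` then `c - z k` is invertible in the
algebra, hence so is `c - f` along the axis; thus `|h| ≤ 1`, and the Schwarz lemma for `g` and `h`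
gives `|g' 0| = 1`. As the derivative of `φ z k` at `0` vanishes where `z k` does, it is
`g' 0 * z k`. The equality case of the Schwarz lemma, on the open set of directions in which the
`k`-th coordinate is the largest one, followed by the identity theorem gives `φ z k = g' 0 * z k`.
-/

open Metric Filter Topology Set

section Schwarz

theorem fderiv_apply_eq_zero_of_eventually_smul {𝕜 E F : Type*} [NontriviallyNormedField 𝕜]
    [NormedAddCommGroup E] [NormedSpace 𝕜 E] [NormedAddCommGroup F] [NormedSpace 𝕜 F] {f : E → F}
    {v : E} (hf : DifferentiableAt 𝕜 f 0) (h : ∀ᶠ t : 𝕜 in 𝓝 0, f (t • v) = 0) :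
    fderiv 𝕜 f 0 v = 0 := by
  have hline : (fun t : 𝕜 => f (0 + t • v)) =ᶠ[𝓝 0] fun _ => 0 := by
    simp only [zero_add]
    exact h
  rw [← hf.lineDeriv_eq_fderiv, lineDeriv, hline.deriv_eq, deriv_const]

theorem norm_deriv_eq_one_of_leftInverse {g h : ℂ → ℂ} (hg : DifferentiableOn ℂ g (ball 0 1))
    (hh : DifferentiableOn ℂ h (ball 0 1)) (hgB : MapsTo g (ball 0 1) (closedBall 0 1))
    (hhB : MapsTo h (ball 0 1) (closedBall 0 1)) (hg0 : g 0 = 0)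
    (hhg : ∀ w ∈ ball (0 : ℂ) 1, h (g w) = w) : ‖deriv g 0‖ = 1 := by
  have hball : ball (0 : ℂ) 1 ∈ 𝓝 0 := ball_mem_nhds 0 one_pos
  have hh0 : h 0 = 0 := by simpa only [hg0] using hhg 0 (mem_ball_self one_pos)
  have hg1 : ‖deriv g 0‖ ≤ 1 :=
    Complex.norm_deriv_le_one_of_mapsTo_ball hg (by rwa [hg0]) one_pos
  have hh1 : ‖deriv h 0‖ ≤ 1 :=
    Complex.norm_deriv_le_one_of_mapsTo_ball hh (by rwa [hh0]) one_pos
  have hderiv : deriv h 0 * deriv g 0 = 1 := by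
    have hcomp := deriv_comp (0 : ℂ) (hg0.symm ▸ hh.differentiableAt hball)
      (hg.differentiableAt hball)
    have hid : h ∘ g =ᶠ[𝓝 0] id := Filter.eventually_of_mem hball hhg
    rw [← hg0, ← deriv_id (0 : ℂ), ← hid.deriv_eq, hcomp, hg0]
  refine le_antisymm hg1 ?_
  calc 1 = ‖deriv h 0‖ * ‖deriv g 0‖ := by rw [← norm_mul, hderiv, norm_one]
    _ ≤ ‖deriv g 0‖ := mul_le_of_le_one_left (norm_nonneg _) hh1

variable {E F : Type*} [NormedAddCommGroup E] [NormedSpace ℂ E] [NormedAddCommGroup F]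
  [NormedSpace ℂ F] [StrictConvexSpace ℝ F] {f : E → F}

theorem eq_fderiv_apply_of_norm_eq (hf : DifferentiableOn ℂ f (ball 0 1))
    (hmaps : MapsTo f (ball 0 1) (closedBall 0 1)) (h0 : f 0 = 0) {z : E} (hz : z ∈ ball 0 1)
    (hnorm : ‖fderiv ℂ f 0 z‖ = ‖z‖) : f z = fderiv ℂ f 0 z := by
  rcases eq_or_ne z 0 with rfl | hz0
  · rw [h0, map_zero]
  have hzpos : 0 < ‖z‖ := norm_pos_iff.2 hz0
  have hline : MapsTo (fun w : ℂ => w • z) (ball 0 ‖z‖⁻¹) (ball 0 1) := fun w hw => by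
    rw [mem_ball_zero_iff] at hw ⊢
    rwa [norm_smul, ← lt_inv_mul_iff₀' hzpos, mul_one]
  have hderiv : deriv (fun w : ℂ => f (w • z)) 0 = fderiv ℂ f 0 z := by
    have hf0 : DifferentiableAt ℂ f 0 := hf.differentiableAt (ball_mem_nhds 0 one_pos)
    simpa only [lineDeriv, zero_add] using hf0.lineDeriv_eq_fderiv (v := z)
  have haffine := Complex.affine_of_mapsTo_ball_of_norm_dslope_eq_div (z₀ := 0) (R₂ := 1)
    (hf.comp (by fun_prop) hline) (by simpa [h0] using hmaps.comp hline)
    (mem_ball_self (inv_pos.2 hzpos)) (by simp [Function.comp_def, hderiv, hnorm])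
  have h1 : (1 : ℂ) ∈ ball 0 ‖z‖⁻¹ := by
    rw [mem_ball_zero_iff, norm_one]
    exact (one_lt_inv₀ hzpos).2 (mem_ball_zero_iff.1 hz)
  simpa [Function.comp_def, h0, hderiv] using haffine h1

theorem eqOn_fderiv_of_eventually_norm_eq (hf : AnalyticOnNhd ℂ f (ball 0 1))
    (hmaps : MapsTo f (ball 0 1) (closedBall 0 1)) (h0 : f 0 = 0) {x : E} (hx : x ∈ ball 0 1)
    (hnorm : ∀ᶠ z in 𝓝 x, ‖fderiv ℂ f 0 z‖ = ‖z‖) : EqOn f (fderiv ℂ f 0) (ball 0 1) := by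
  refine hf.eqOn_of_preconnected_of_eventuallyEq ((fderiv ℂ f 0).analyticOnNhd _)
    (convex_ball _ _).isPreconnected hx ?_
  filter_upwards [hnorm, isOpen_ball.mem_nhds hx] with z hz hzB
  exact eq_fderiv_apply_of_norm_eq hf.differentiableOn hmaps h0 hzB hz

end Schwarz

namespace WienerPolydisc

section Coordinates

theorem norm_apply_le (z : C0) (k : ℕ) : ‖z k‖ ≤ ‖z‖ :=
  BoundedContinuousFunction.norm_coe_le_norm z.toBCF k

theorem norm_le_of_forall {z : C0} {r : ℝ} (hr : 0 ≤ r) (h : ∀ j, ‖z j‖ ≤ r) : ‖z‖ ≤ r :=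
  (BoundedContinuousFunction.norm_le (f := z.toBCF) hr).2 h

/-- The `k`-th coordinate functional on `c₀`. -/
noncomputable def coordCLM (k : ℕ) : C0 →L[ℂ] ℂ :=
  LinearMap.mkContinuous
    { toFun := fun z => z k
      map_add' := fun _ _ => rfl
      map_smul' := fun _ _ => rfl } 1 fun z => by
    rw [one_mul]
    exact norm_apply_le z k

/-- The `k`-th vector of the canonical basis of `c₀`. -/
noncomputable def basisVec (k : ℕ) : C0 where
  toFun := Pi.single k 1
  continuous_toFun := continuous_of_discreteTopology
  zero_at_infty' := by
    rw [cocompact_eq_cofinite]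
    refine tendsto_const_nhds.congr' ?_
    filter_upwards [(finite_singleton k).compl_mem_cofinite] with j hj
    exact (Pi.single_eq_of_ne (M := fun _ => ℂ) hj 1).symm

theorem basisVec_self (k : ℕ) : basisVec k k = 1 := Pi.single_eq_same (M := fun _ => ℂ) k 1

theorem basisVec_of_ne {k j : ℕ} (h : j ≠ k) : basisVec k j = 0 :=
  Pi.single_eq_of_ne (M := fun _ => ℂ) h 1

theorem norm_basisVec (k : ℕ) : ‖basisVec k‖ = 1 := by
  refine le_antisymm (norm_le_of_forall zero_le_one fun j => ?_) ?_
  · rcases eq_or_ne j k with rfl | h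
    · rw [basisVec_self, norm_one]
    · rw [basisVec_of_ne h, norm_zero]
      exact zero_le_one
  · simpa only [basisVec_self, norm_one] using norm_apply_le (basisVec k) k

theorem smul_basisVec_self (k : ℕ) (w : ℂ) : (w • basisVec k) k = w := by
  rw [ZeroAtInftyContinuousMap.smul_apply, basisVec_self, smul_eq_mul, mul_one]

theorem smul_basisVec_of_ne {k j : ℕ} (h : j ≠ k) (w : ℂ) : (w • basisVec k) j = 0 := by
  rw [ZeroAtInftyContinuousMap.smul_apply, basisVec_of_ne h, smul_zero]

theorem eq_smul_basisVec {z : C0} {k : ℕ} (h : ∀ j, j ≠ k → z j = 0) : z = z k • basisVec k := by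
  ext j
  rcases eq_or_ne j k with rfl | hj
  · rw [smul_basisVec_self]
  · rw [smul_basisVec_of_ne hj, h j hj]

theorem smul_basisVec_mem_B {k : ℕ} {w : ℂ} : w • basisVec k ∈ B ↔ w ∈ ball 0 1 := by
  rw [mem_B_iff, norm_smul, norm_basisVec, mul_one, mem_ball_zero_iff]

theorem zero_mem_B : (0 : C0) ∈ B := mem_ball_self one_pos

theorem eventually_norm_apply_eq_norm (k : ℕ) :
    ∀ᶠ z in 𝓝 ((1 / 2 : ℂ) • basisVec k), ‖z k‖ = ‖z‖ := by
  filter_upwards [ball_mem_nhds _ (show (0 : ℝ) < 1 / 4 by norm_num)] with z hz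
  have hdist (j : ℕ) : ‖z j - ((1 / 2 : ℂ) • basisVec k) j‖ < 1 / 4 :=
    (norm_apply_le (z - (1 / 2 : ℂ) • basisVec k) j).trans_lt (mem_ball_iff_norm.1 hz)
  have hk : 1 / 4 ≤ ‖z k‖ := by
    have hlt := hdist k
    rw [smul_basisVec_self, norm_sub_rev] at hlt
    have hle := norm_sub_norm_le (1 / 2 : ℂ) (z k)
    have hhalf : ‖(1 / 2 : ℂ)‖ = 1 / 2 := by norm_num
    linarith
  refine le_antisymm (norm_apply_le z k) (norm_le_of_forall (norm_nonneg _) fun j => ?_)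
  rcases eq_or_ne j k with rfl | hj
  · exact le_rfl
  · have hlt := hdist j
    rw [smul_basisVec_of_ne hj, sub_zero] at hlt
    exact hlt.le.trans hk

end Coordinates

section TaylorSeries

theorem coeff_injective : Function.Injective coeff := fun f g h =>
  Subtype.ext <| funext fun z =>
    ((isExpansion_coeff f).hasSum z).unique (h ▸ (isExpansion_coeff g).hasSum z)

theorem exists_coeff_eq {a : (ℕ →₀ ℕ) → ℂ} (ha : Summable fun α => ‖a α‖) :
    ∃ f, coeff f = a := by
  have hexp : IsExpansion a fun z => ∑' α, a α * monom α z :=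
    ⟨ha, fun z => (summable_norm_mul_monom ha z).of_norm.hasSum⟩
  exact ⟨⟨_, a, hexp⟩, coeff_eq _ hexp⟩

/-- The sum of the Taylor series of `f`, as a function on the whole of `c₀`, so that it can be
differentiated. Only its values on the ball are meaningful. -/
noncomputable def taylorSum (f : wienerAlgebra) (z : C0) : ℂ := ∑' α, coeff f α * monom α z

theorem taylorSum_of_mem (f : wienerAlgebra) {z : C0} (hz : z ∈ B) :
    taylorSum f z = f.1 ⟨z, hz⟩ :=
  ((isExpansion_coeff f).hasSum ⟨z, hz⟩).tsum_eq

theorem differentiable_monom_smul (α : ℕ →₀ ℕ) (v : C0) :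
    Differentiable ℂ fun w : ℂ => monom α (w • v) := by
  simp only [monom, Finsupp.prod, ZeroAtInftyContinuousMap.smul_apply, smul_eq_mul]
  fun_prop

theorem differentiableOn_taylorSum_smul (f : wienerAlgebra) {v : C0} (hv : ‖v‖ ≤ 1) :
    DifferentiableOn ℂ (fun w : ℂ => taylorSum f (w • v)) (ball 0 1) := by
  refine Complex.differentiableOn_tsum_of_summable_norm (isExpansion_coeff f).summable
    (fun α => ((differentiable_monom_smul α v).const_mul _).differentiableOn) isOpen_ball
    fun α w hw => ?_
  have hmem : w • v ∈ B := by
    rw [mem_B_iff, norm_smul]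
    exact mul_lt_one_of_nonneg_of_lt_one_left (norm_nonneg _) (mem_ball_zero_iff.1 hw) hv
  rw [norm_mul]
  exact mul_le_of_le_one_right (norm_nonneg _) (norm_monom_le_one α ⟨w • v, hmem⟩)

end TaylorSeries

section CoordinateFunctions

theorem isExpansion_extend_single {b : ℕ → ℂ} (hb : Summable fun n => ‖b n‖) {k : ℕ} {f : B → ℂ}
    (h : ∀ z : B, HasSum (fun n => b n * (z : C0) k ^ n) (f z)) :
    IsExpansion (Function.extend (Finsupp.single k) b 0) f := by
  have hinj : Function.Injective (Finsupp.single k : ℕ → ℕ →₀ ℕ) := Finsupp.single_injective k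
  have h0 (α : ℕ →₀ ℕ) (hα : α ∉ range (Finsupp.single k)) :
      Function.extend (Finsupp.single k) b 0 α = 0 := Function.extend_apply' _ _ _ hα
  have hmonom (n : ℕ) (z : C0) : monom (Finsupp.single k n) z = z k ^ n :=
    Finsupp.prod_single_index (pow_zero _)
  constructor
  · refine (hinj.summable_iff fun α hα => by rw [h0 α hα, norm_zero]).1 ?_
    simpa only [Function.comp_def, hinj.extend_apply] using hb
  · intro z
    refine (hinj.hasSum_iff fun α hα => by rw [h0 α hα, zero_mul]).1 ?_
    simpa only [Function.comp_def, hinj.extend_apply, hmonom] using h z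

/-- The coordinate function `z ↦ z k`, as an element of the Wiener algebra. -/
noncomputable def coord (k : ℕ) : wienerAlgebra :=
  ⟨fun z => (z : C0) k, _, isExpansion_extend_single (b := Pi.single 1 1) (k := k)
    (summable_of_ne_finset_zero (s := {1}) fun n hn => by
      rw [Pi.single_eq_of_ne (Finset.notMem_singleton.1 hn), norm_zero])
    fun z => by
      simpa using hasSum_single (f := fun n => (Pi.single 1 1 : ℕ → ℂ) n * (z : C0) k ^ n) 1
        fun n hn => by simp [hn]⟩

theorem sub_apply_ne_zero {c : ℂ} (hc : 1 < ‖c‖) (z : B) (k : ℕ) : c - (z : C0) k ≠ 0 :=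
  sub_ne_zero.2 fun h => (norm_apply_lt_one z k).not_gt (h ▸ hc)

theorem inv_sub_apply_mem_wienerAlgebra {c : ℂ} (hc : 1 < ‖c‖) (k : ℕ) :
    (fun z : B => (c - (z : C0) k)⁻¹) ∈ wienerAlgebra := by
  have hc0 : c ≠ 0 := norm_pos_iff.1 (one_pos.trans hc)
  have hinv : ‖c⁻¹‖ < 1 := by
    rw [norm_inv]
    exact inv_lt_one_of_one_lt₀ hc
  refine ⟨_, isExpansion_extend_single (b := fun n => c⁻¹ * c⁻¹ ^ n) (k := k) ?_ fun z => ?_⟩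
  · simp only [norm_mul, norm_pow]
    exact (summable_geometric_of_lt_one (norm_nonneg _) hinv).mul_left _
  · have hz : ‖c⁻¹ * (z : C0) k‖ < 1 := by
      rw [norm_mul]
      exact mul_lt_one_of_nonneg_of_lt_one_left (norm_nonneg _) hinv (norm_apply_lt_one z k).le
    have hsum : c⁻¹ * (1 - c⁻¹ * (z : C0) k)⁻¹ = (c - (z : C0) k)⁻¹ := by
      rw [← mul_inv, mul_sub, mul_one, mul_inv_cancel_left₀ hc0]
    simpa only [hsum, mul_pow, mul_assoc] using (hasSum_geometric_of_norm_lt_one hz).mul_left c⁻¹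

theorem isUnit_algebraMap_sub_coord {c : ℂ} (hc : 1 < ‖c‖) (k : ℕ) :
    IsUnit (algebraMap ℂ wienerAlgebra c - coord k) :=
  IsUnit.of_mul_eq_one ⟨_, inv_sub_apply_mem_wienerAlgebra hc k⟩ <|
    Subtype.ext <| funext fun z => mul_inv_cancel₀ (sub_apply_ne_zero hc z k)

end CoordinateFunctions

section WeightedPermutation

/-- The value `ε ^ α = ∏ j, ε j ^ α j` of a monomial at a sequence `ε` that need not lie in `c₀`. -/
noncomputable def multiplier (ε : ℕ → ℂ) (α : ℕ →₀ ℕ) : ℂ := α.prod fun j m => ε j ^ m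

variable {σ : Equiv.Perm ℕ} {ε : ℕ → ℂ} {ψ : B → B}

theorem norm_multiplier (hε : ∀ j, ‖ε j‖ = 1) (α : ℕ →₀ ℕ) : ‖multiplier ε α‖ = 1 := by
  rw [multiplier, Finsupp.prod, norm_prod]
  exact Finset.prod_eq_one fun j _ => by rw [norm_pow, hε, one_pow]

theorem multiplier_ne_zero (hε : ∀ j, ‖ε j‖ = 1) (α : ℕ →₀ ℕ) : multiplier ε α ≠ 0 :=
  norm_ne_zero_iff.1 <| (norm_multiplier hε α).symm ▸ one_ne_zero

theorem monom_of_forall_apply_eq {z y : C0} (h : ∀ j, y j = ε j * z (σ j)) (α : ℕ →₀ ℕ) :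
    monom α y = multiplier ε α * monom (Finsupp.equivCongrLeft σ α) z := by
  rw [Finsupp.equivCongrLeft_apply, monom, multiplier, monom, Finsupp.prod_equivMapDomain,
    ← Finsupp.prod_mul]
  exact Finsupp.prod_congr fun j _ => by rw [h, mul_pow]

theorem IsExpansion.comp_weightedPerm (hε : ∀ j, ‖ε j‖ = 1)
    (hψ : ∀ z : B, ∀ j, (ψ z : C0) j = ε j * (z : C0) (σ j)) {a : (ℕ →₀ ℕ) → ℂ} {f : B → ℂ}
    (hf : IsExpansion a f) :
    IsExpansion ((fun α => multiplier ε α * a α) ∘ (Finsupp.equivCongrLeft σ).symm) (f ∘ ψ) where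
  summable := by
    refine ((Finsupp.equivCongrLeft σ).symm.summable_iff
      (f := fun α => ‖multiplier ε α * a α‖)).2 ?_
    simpa only [norm_mul, norm_multiplier hε, one_mul] using hf.summable
  hasSum z := by
    rw [Function.comp_apply (f := f), ← (Finsupp.equivCongrLeft σ).hasSum_iff]
    convert hf.hasSum (ψ z) using 2 with α
    rw [Function.comp_apply, Function.comp_apply, Equiv.symm_apply_apply,
      monom_of_forall_apply_eq (hψ z)]
    ring

variable {hC : MapsWienerAlgebra ψ}

theorem coeff_compOp_weightedPerm (hε : ∀ j, ‖ε j‖ = 1)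
    (hψ : ∀ z : B, ∀ j, (ψ z : C0) j = ε j * (z : C0) (σ j)) (f : wienerAlgebra) (α : ℕ →₀ ℕ) :
    coeff (compOp ψ hC f) (Finsupp.equivCongrLeft σ α) = multiplier ε α * coeff f α := by
  rw [coeff_eq (compOp ψ hC f) ((isExpansion_coeff f).comp_weightedPerm hε hψ),
    Function.comp_apply, Equiv.symm_apply_apply]

theorem isIsometric_compOp_weightedPerm (hε : ∀ j, ‖ε j‖ = 1)
    (hψ : ∀ z : B, ∀ j, (ψ z : C0) j = ε j * (z : C0) (σ j)) : IsIsometric (compOp ψ hC) :=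
  fun f => calc
    wienerNorm (compOp ψ hC f)
      = ∑' α, ‖coeff (compOp ψ hC f) (Finsupp.equivCongrLeft σ α)‖ :=
        ((Finsupp.equivCongrLeft σ).tsum_eq fun α => ‖coeff (compOp ψ hC f) α‖).symm
    _ = wienerNorm f := by
        simp only [coeff_compOp_weightedPerm hε hψ, norm_mul, norm_multiplier hε, one_mul,
          wienerNorm]

theorem injective_compOp_weightedPerm (hε : ∀ j, ‖ε j‖ = 1)
    (hψ : ∀ z : B, ∀ j, (ψ z : C0) j = ε j * (z : C0) (σ j)) :
    Function.Injective (compOp ψ hC) := fun f g hfg =>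
  coeff_injective <| funext fun α => mul_left_cancel₀ (multiplier_ne_zero hε α) <| by
    rw [← coeff_compOp_weightedPerm (hC := hC) hε hψ, hfg, coeff_compOp_weightedPerm hε hψ]

theorem surjective_compOp_weightedPerm (hε : ∀ j, ‖ε j‖ = 1)
    (hψ : ∀ z : B, ∀ j, (ψ z : C0) j = ε j * (z : C0) (σ j)) :
    Function.Surjective (compOp ψ hC) := fun g => by
  obtain ⟨f, hf⟩ : ∃ f, coeff f =
      fun α => (multiplier ε α)⁻¹ * coeff g (Finsupp.equivCongrLeft σ α) := by
    refine exists_coeff_eq ?_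
    simp only [norm_mul, norm_inv, norm_multiplier hε, inv_one, one_mul]
    exact (Finsupp.equivCongrLeft σ).summable_iff.2 (isExpansion_coeff g).summable
  refine ⟨f, coeff_injective <| funext <|
    (Finsupp.equivCongrLeft σ).surjective.forall.2 fun α => ?_⟩
  rw [coeff_compOp_weightedPerm hε hψ, hf, mul_inv_cancel_left₀ (multiplier_ne_zero hε α)]

theorem isAutomorphism_compOp_weightedPerm (hε : ∀ j, ‖ε j‖ = 1)
    (hψ : ∀ z : B, ∀ j, (ψ z : C0) j = ε j * (z : C0) (σ j)) : IsAutomorphism (compOp ψ hC) :=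
  ⟨AlgEquiv.ofBijective (compOp ψ hC)
    ⟨injective_compOp_weightedPerm hε hψ, surjective_compOp_weightedPerm hε hψ⟩, rfl⟩

end WeightedPermutation

section Rigidity

theorem IsAutomorphism.surjective {T : wienerAlgebra →ₐ[ℂ] wienerAlgebra} (hT : IsAutomorphism T) :
    Function.Surjective T := by
  obtain ⟨e, rfl⟩ := hT
  exact e.surjective

theorem injective_of_surjective_compOp {ψ : B → B} {hC : MapsWienerAlgebra ψ}
    (hsurj : Function.Surjective (compOp ψ hC)) : Function.Injective ψ := by
  refine fun x y hxy => Subtype.ext <| ZeroAtInftyContinuousMap.ext fun k => ?_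
  obtain ⟨f, hf⟩ := hsurj (coord k)
  have hfψ (z : B) : f.1 (ψ z) = (z : C0) k := congrFun (congrArg Subtype.val hf) z
  rw [← hfψ x, hxy, hfψ y]

variable {φ : C0 → C0}

theorem map_zero_of_hyperplanes (h : ∀ k, ∀ z ∈ B, z k = 0 → φ z k = 0) : φ 0 = 0 :=
  ZeroAtInftyContinuousMap.ext fun k => h k 0 zero_mem_B rfl

theorem map_axis_of_hyperplanes (h : ∀ k, ∀ z ∈ B, z k = 0 → φ z k = 0) (k : ℕ) {w : ℂ}
    (hw : w ∈ ball 0 1) : φ (w • basisVec k) = φ (w • basisVec k) k • basisVec k :=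
  eq_smul_basisVec fun j hj => h j _ (smul_basisVec_mem_B.2 hw) (smul_basisVec_of_ne hj w)

theorem analyticOnNhd_apply (hφ : AnalyticOnNhd ℂ φ B) (k : ℕ) :
    AnalyticOnNhd ℂ (fun z => φ z k) B :=
  (coordCLM k).comp_analyticOnNhd hφ

theorem differentiableOn_axis (hφ : AnalyticOnNhd ℂ φ B) (k : ℕ) :
    DifferentiableOn ℂ (fun w : ℂ => φ (w • basisVec k) k) (ball 0 1) :=
  (analyticOnNhd_apply hφ k).differentiableOn.comp (by fun_prop) fun _ => smul_basisVec_mem_B.2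

variable {hB : MapsTo φ B B} {hC : MapsWienerAlgebra (hB.restrict φ B B)}

theorem taylorSum_map (f : wienerAlgebra) {z : C0} (hz : z ∈ B) :
    taylorSum f (φ z) = taylorSum (compOp _ hC f) z := by
  rw [taylorSum_of_mem f (hB hz), taylorSum_of_mem _ hz]
  rfl

theorem taylorSum_axis_eq_zero (hφ : AnalyticOnNhd ℂ φ B)
    (h : ∀ k, ∀ z ∈ B, z k = 0 → φ z k = 0) (hinj : Function.Injective (hB.restrict φ B B))
    {f : wienerAlgebra} (hf : compOp _ hC f = 0) (k : ℕ) {w : ℂ} (hw : w ∈ ball 0 1) :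
    taylorSum f (w • basisVec k) = 0 := by
  set g : ℂ → ℂ := fun w => φ (w • basisVec k) k
  have hφg {w : ℂ} (hw : w ∈ ball 0 1) : φ (w • basisVec k) = g w • basisVec k :=
    map_axis_of_hyperplanes h k hw
  have hg0 : g 0 = 0 := by simp only [g, zero_smul, map_zero_of_hyperplanes h]; rfl
  have hball : ball (0 : ℂ) 1 ∈ 𝓝 0 := ball_mem_nhds 0 one_pos
  have hgne : ∀ᶠ w in 𝓝[≠] 0, g w ≠ 0 := by
    filter_upwards [self_mem_nhdsWithin, mem_nhdsWithin_of_mem_nhds hball] with w hw0 hw hgw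
    have hφw : φ (w • basisVec k) = φ 0 := by
      rw [hφg hw, hgw, zero_smul, map_zero_of_hyperplanes h]
    have hw0' : w • basisVec k = 0 := congrArg Subtype.val <|
      @hinj ⟨_, smul_basisVec_mem_B.2 hw⟩ ⟨0, zero_mem_B⟩ (Subtype.ext hφw)
    exact hw0 (by rw [← smul_basisVec_self k w, hw0']; rfl)
  have hglim : Tendsto g (𝓝[≠] 0) (𝓝[≠] 0) := by
    have hcont : ContinuousAt g 0 :=
      ((differentiableOn_axis hφ k).differentiableAt hball).continuousAt
    refine tendsto_nhdsWithin_iff.2 ⟨?_, hgne⟩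
    simpa only [hg0] using hcont.tendsto.mono_left nhdsWithin_le_nhds
  have hzero : ∀ᶠ w in 𝓝[≠] 0, taylorSum f (g w • basisVec k) = 0 := by
    filter_upwards [mem_nhdsWithin_of_mem_nhds hball] with w hw
    rw [← hφg hw, taylorSum_map (hC := hC) f (smul_basisVec_mem_B.2 hw), hf,
      taylorSum_of_mem _ (smul_basisVec_mem_B.2 hw)]
    rfl
  have hline := (differentiableOn_taylorSum_smul f (norm_basisVec k).le).analyticOnNhd isOpen_ball
  exact hline.eqOn_zero_of_preconnected_of_frequently_eq_zero (convex_ball 0 1).isPreconnected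
    (mem_ball_self one_pos) (hglim.frequently hzero.frequently) hw

theorem norm_taylorSum_axis_le_one (hφ : AnalyticOnNhd ℂ φ B)
    (h : ∀ k, ∀ z ∈ B, z k = 0 → φ z k = 0) (hsurj : Function.Surjective (compOp _ hC)) {k : ℕ}
    {f : wienerAlgebra} (hf : compOp _ hC f = coord k) {w : ℂ} (hw : w ∈ ball 0 1) :
    ‖taylorSum f (w • basisVec k)‖ ≤ 1 := by
  by_contra! hc
  set c : ℂ := taylorSum f (w • basisVec k)
  obtain ⟨r, hr⟩ := (isUnit_algebraMap_sub_coord hc k).exists_right_inv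
  obtain ⟨q, rfl⟩ := hsurj r
  have hker : compOp _ hC ((algebraMap ℂ wienerAlgebra c - f) * q - 1) = 0 := by
    rw [map_sub, map_mul, map_sub, AlgHom.commutes, hf, hr, map_one, sub_self]
  have hwB := smul_basisVec_mem_B (k := k).2 hw
  have hvalue := taylorSum_axis_eq_zero hφ h (injective_of_surjective_compOp hsurj) hker k hw
  rw [taylorSum_of_mem _ hwB] at hvalue
  have hfc : f.1 ⟨_, hwB⟩ = c := (taylorSum_of_mem f hwB).symm
  have hvalue' : (c - f.1 ⟨_, hwB⟩) * q.1 ⟨_, hwB⟩ - 1 = 0 := hvalue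
  rw [hfc, sub_self, zero_mul, zero_sub] at hvalue'
  exact neg_ne_zero.2 one_ne_zero hvalue'

theorem norm_fderiv_basisVec (hφ : AnalyticOnNhd ℂ φ B)
    (h : ∀ k, ∀ z ∈ B, z k = 0 → φ z k = 0) (hsurj : Function.Surjective (compOp _ hC)) (k : ℕ) :
    ‖fderiv ℂ (fun z => φ z k) 0 (basisVec k)‖ = 1 := by
  obtain ⟨f, hf⟩ := hsurj (coord k)
  have hderiv := (analyticOnNhd_apply hφ k 0 zero_mem_B).differentiableAt.lineDeriv_eq_fderiv
    (v := basisVec k)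
  rw [← hderiv, lineDeriv]
  simp only [zero_add]
  refine norm_deriv_eq_one_of_leftInverse (h := fun w => taylorSum f (w • basisVec k))
    (differentiableOn_axis hφ k) (differentiableOn_taylorSum_smul f (norm_basisVec k).le)
    (fun w hw => mem_closedBall_zero_iff.2 ?_)
    (fun w hw => mem_closedBall_zero_iff.2 (norm_taylorSum_axis_le_one hφ h hsurj hf hw)) ?_
    fun w hw => ?_
  · exact (norm_apply_lt_one ⟨_, hB (smul_basisVec_mem_B.2 hw)⟩ k).le
  · simp only [zero_smul]
    exact h k 0 zero_mem_B rfl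
  · have hwB := smul_basisVec_mem_B (k := k).2 hw
    rw [← map_axis_of_hyperplanes h k hw, taylorSum_map (hC := hC) f hwB, hf,
      taylorSum_of_mem _ hwB]
    exact smul_basisVec_self k w

theorem fderiv_apply_eq_mul (hφ : AnalyticOnNhd ℂ φ B) {k : ℕ}
    (h : ∀ z ∈ B, z k = 0 → φ z k = 0) (z : C0) :
    fderiv ℂ (fun z => φ z k) 0 z = fderiv ℂ (fun z => φ z k) 0 (basisVec k) * z k := by
  have hker : fderiv ℂ (fun z => φ z k) 0 (z - z k • basisVec k) = 0 := by
    refine fderiv_apply_eq_zero_of_eventually_smul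
      (analyticOnNhd_apply hφ k 0 zero_mem_B).differentiableAt ?_
    have hcont : Continuous fun t : ℂ => t • (z - z k • basisVec k) := by fun_prop
    have hline : Tendsto (fun t : ℂ => t • (z - z k • basisVec k)) (𝓝 0) (𝓝 0) := by
      simpa only [zero_smul] using hcont.tendsto 0
    filter_upwards [hline (isOpen_ball.mem_nhds zero_mem_B)] with t ht
    refine h _ ht ?_
    rw [ZeroAtInftyContinuousMap.smul_apply, ZeroAtInftyContinuousMap.sub_apply,
      smul_basisVec_self, sub_self, smul_zero]
  rwa [map_sub, map_smul, sub_eq_zero, smul_eq_mul, mul_comm] at hker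

theorem exists_eq_mul_of_surjective_compOp (hφ : AnalyticOnNhd ℂ φ B)
    (h : ∀ k, ∀ z ∈ B, z k = 0 → φ z k = 0) (hsurj : Function.Surjective (compOp _ hC)) (k : ℕ) :
    ∃ c : ℂ, ‖c‖ = 1 ∧ ∀ z ∈ B, φ z k = c * z k := by
  have hc := norm_fderiv_basisVec hφ h hsurj k
  refine ⟨_, hc, fun z hz => (fderiv_apply_eq_mul hφ (h k) z).symm ▸ ?_⟩
  refine eqOn_fderiv_of_eventually_norm_eq (analyticOnNhd_apply hφ k)
    (fun z hz => mem_closedBall_zero_iff.2 (norm_apply_lt_one ⟨_, hB hz⟩ k).le)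
    (h k 0 zero_mem_B rfl) (x := (1 / 2 : ℂ) • basisVec k)
    (smul_basisVec_mem_B.2 (mem_ball_zero_iff.2 (by norm_num))) ?_ hz
  filter_upwards [eventually_norm_apply_eq_norm k] with y hy
  rw [fderiv_apply_eq_mul hφ (h k), norm_mul, hc, one_mul, hy]

end Rigidity

end WienerPolydisc

open WienerPolydisc in
theorem theorem3p2_general (φ : C0 → C0) (hφ : AnalyticOnNhd ℂ φ B) (hB : MapsTo φ B B)
    (hC : MapsWienerAlgebra (hB.restrict φ B B)) :
    ((∃ (σ : Equiv.Perm ℕ) (ε : ℕ → ℂ), (∀ j, ‖ε j‖ = 1) ∧ ∀ z ∈ B, ∀ j, φ z j = ε j * z (σ j)) →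
      IsAutomorphism (compOp _ hC) ∧ IsIsometric (compOp _ hC)) ∧
    (Function.Surjective (compOp _ hC) → (∀ k, ∀ z ∈ B, z k = 0 → φ z k = 0) →
      ∃ ε : ℕ → ℂ, (∀ j, ‖ε j‖ = 1) ∧ ∀ z ∈ B, ∀ j, φ z j = ε j * z j) := by
  constructor
  · rintro ⟨σ, ε, hε, hperm⟩
    have hψ (z : B) : ∀ j, (hB.restrict φ B B z : C0) j = ε j * (z : C0) (σ j) := hperm z z.2
    exact ⟨isAutomorphism_compOp_weightedPerm hε hψ, isIsometric_compOp_weightedPerm hε hψ⟩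
  · intro hsurj hhyp
    choose ε hε hφε using exists_eq_mul_of_surjective_compOp hφ hhyp hsurj
    exact ⟨ε, hε, fun z hz j => hφε j z hz⟩

theorem theorem3p2 (φ : WienerPolydisc.C0 → WienerPolydisc.C0)
    (hφ : AnalyticOnNhd ℂ φ WienerPolydisc.B)
    (hB : Set.MapsTo φ WienerPolydisc.B WienerPolydisc.B)
    (hC : WienerPolydisc.MapsWienerAlgebra (hB.restrict φ WienerPolydisc.B WienerPolydisc.B)) :
    -- (a)
    ((∃ (σ : Equiv.Perm ℕ) (ε : ℕ → ℂ), (∀ j, ‖ε j‖ = 1) ∧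
        ∀ z ∈ WienerPolydisc.B, ∀ j, φ z j = ε j * z (σ j)) →
      WienerPolydisc.IsAutomorphism (WienerPolydisc.compOp _ hC) ∧
        WienerPolydisc.IsIsometric (WienerPolydisc.compOp _ hC)) ∧
    -- (b)
    (WienerPolydisc.IsAutomorphism (WienerPolydisc.compOp _ hC) →
      (∃ (d : ℕ → ℕ) (u : ℕ → WienerPolydisc.C0 → ℂ),
        (∀ k, 1 ≤ d k ∧ ContinuousOn (u k) WienerPolydisc.B ∧ u k 0 ≠ 0) ∧
        ∀ k, ∀ z ∈ WienerPolydisc.B, φ z k = z k ^ d k * u k z) →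
      ∃ ε : ℕ → ℂ, (∀ j, ‖ε j‖ = 1) ∧
        ∀ z ∈ WienerPolydisc.B, ∀ j, φ z j = ε j * z j) :=
  ⟨(theorem3p2_general φ hφ hB hC).1, fun haut ⟨_, _, hdu, h⟩ =>
    (theorem3p2_general φ hφ hB hC).2 haut.surjective fun k z hz hzk => by
      rw [h k z hz, hzk, zero_pow (Nat.one_le_iff_ne_zero.1 (hdu k).1), zero_mul]⟩
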